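/- Let $0<\beta\le 1$ and let $E_\beta(x)=\sum_{k\ge 0}x^k/\Gamma(\beta k+1)$. Let $\mathcal S$ be a finite set and let $Q$ be the transition matrix of an irreducible, aperiodic Markov chain $(X_n)_{n\ge 0}$ on $\mathcal S$, with invariant distribution $\pi$. Let $T_1,T_2,\dots$ be i.i.d. random variables, independent of $(X_n)$, with the Mittag-Leffler$(\beta)$ distribution, i.e. $\mathbb P\{T_k>t\}=E_\beta(-t^\beta)$ for $t\ge 0$. Put $S_n=T_1+\dots+T_n$ (with $S_0=0$), $N(t)=\max\{n\ge 0: S_n\le t\}$, and let $X(t)=X_{N(t)}$ be the resulting semi-Markov process, with transition probabilities $p_{i,j}(t)=\mathbb P\{X(t)=j\mid X(0)=i\}$. Write $\|\mu-\nu\|=\sup_{A\subseteq\mathcal S}|\mu(A)-\nu(A)|$, and for $\varepsilon>0$ define \[ T^{\rm emb}_\varepsilon=\inf\Big\{n\ge 0:\sum_{i\in\mathcal S}\|(Q^n)_{i,\cdot}-\pi\|\le\varepsilon\Big\},\qquad T^{\rm cont}_\varepsilon=\inf\Big\{t\ge 0:\sum_{i\in\mathcal S}\|p_{i,\cdot}(t)-\pi\|\le\varepsilon\Big\}.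 \] Then there is a constant $C_2>0$, depending only on $\beta$ and on the number of states $|\mathcal S|$, such that for every $\varepsilon$ with $0<\varepsilon<2(|\mathcal S|-1)$ the mixing time $T^{\rm cont}_\varepsilon$ is well defined (the infimum is over a non-empty set) and \[ T^{\rm cont}_{\varepsilon} < C_2\, \varepsilon^{-1/\beta}\, \big(T^{\rm emb}_{\varepsilon/2}\big)^{1/\beta}. \] (The bound on $\varepsilon$ says exactly that $T^{\rm emb}_{\varepsilon/2}\ge 1$; for larger $\varepsilon$ both $T^{\rm emb}_{\varepsilon/2}$ and $T^{\rm cont}_\varepsilon$ are $0$.) -/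

import Mathlib

open MeasureTheory ProbabilityTheory

noncomputable section

namespace SemiMarkov

/-- The one-parameter Mittag-Leffler function `E_β(x) = ∑ₖ xᵏ / Γ(βk + 1)`. -/
def mittagLeffler (β x : ℝ) : ℝ :=
  ∑' k : ℕ, x ^ k / Real.Gamma (β * k + 1)

/-- `μ` is the Mittag-Leffler(β) law: its tail is `μ (t, ∞) = E_β(-t^β)` for all `t ≥ 0`. In
particular (`t = 0`) a probability measure with this property lives on `(0, ∞)`. -/
def IsMittagLefflerLaw (β : ℝ) (μ : Measure ℝ) : Prop :=
  ∀ t : ℝ, 0 ≤ t → μ.real (Set.Ioi t) = mittagLeffler β (-(t ^ β))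

section Chain

variable {S : Type*} [Fintype S]

/-- Total variation distance `sup_A |μ(A) - ν(A)|` of two laws on a finite set, given by their
mass functions. -/
def tvDist (μ ν : S → ℝ) : ℝ :=
  ⨆ A : Finset S, |∑ x ∈ A, μ x - ∑ x ∈ A, ν x|

/-- `π` is a probability vector with `π Q = π`. -/
def IsInvariantLaw (Q : Matrix S S ℝ) (π : S → ℝ) : Prop :=
  π ∈ stdSimplex ℝ S ∧ Matrix.vecMul π Q = π

variable [DecidableEq S]

/-- Aperiodicity: for every state `i`, the greatest common divisor of the possible return times
`{n ≥ 1 : (Qⁿ)ᵢᵢ > 0}` is `1`. -/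
def IsAperiodic (Q : Matrix S S ℝ) : Prop :=
  ∀ i : S, ∀ d : ℕ, (∀ n : ℕ, 1 ≤ n → 0 < (Q ^ n) i i → d ∣ n) → d = 1

/-- The `ε`-mixing time `inf {n : ∑ᵢ ‖(Qⁿ)ᵢ. - π‖ ≤ ε}` of the embedded chain. -/
def embMixingTime (Q : Matrix S S ℝ) (π : S → ℝ) (ε : ℝ) : ℕ :=
  sInf {n : ℕ | ∑ i : S, tvDist (fun j => (Q ^ n) i j) π ≤ ε}

end Chain

section TimeChange

variable {S Ω : Type*}

/-- The event times `S₀ = 0`, `Sₙ = T₁ + ⋯ + Tₙ`; the waiting time `Tₖ₊₁` is `T k`. -/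
def eventTime (T : ℕ → Ω → ℝ) (n : ℕ) (ω : Ω) : ℝ :=
  ∑ k ∈ Finset.range n, T k ω

/-- The counting process `N(t) = max {n : Sₙ ≤ t}`. -/
def eventCount (T : ℕ → Ω → ℝ) (t : ℝ) (ω : Ω) : ℕ :=
  sSup {n : ℕ | eventTime T n ω ≤ t}

/-- The time-changed process `X(t) = X_{N(t)}`. -/
def process (X : ℕ → Ω → S) (T : ℕ → Ω → ℝ) (t : ℝ) (ω : Ω) : S :=
  X (eventCount T t ω) ω

variable [MeasurableSpace Ω]

/-- Under `P`, the sequence `X` is a Markov chain started at `i` with transition matrix `Q`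
(through its finite-dimensional distributions). -/
structure IsMarkovChainFrom [DecidableEq S] [MeasurableSpace S] (P : Measure Ω)
    (Q : Matrix S S ℝ) (i : S) (X : ℕ → Ω → S) : Prop where
  measurable : ∀ n, Measurable (X n)
  path_prob : ∀ (n : ℕ) (x : ℕ → S),
    P.real {ω | ∀ k ≤ n, X k ω = x k} =
      (if x 0 = i then 1 else 0) * ∏ k ∈ Finset.range n, Q (x k) (x (k + 1))

/-- Under `P`, the embedded chain `X` is a Markov chain started at `i` with transition matrix `Q`,
and the waiting times `T` are i.i.d. Mittag-Leffler(β) variables, independent of the chain. -/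
structure IsMittagLefflerSemiMarkovFrom [DecidableEq S] [MeasurableSpace S] (β : ℝ)
    (P : Measure Ω) (Q : Matrix S S ℝ) (i : S) (X : ℕ → Ω → S) (T : ℕ → Ω → ℝ) : Prop where
  isProbabilityMeasure : IsProbabilityMeasure P
  chain : IsMarkovChainFrom P Q i X
  measurable_waiting : ∀ k, Measurable (T k)
  law_waiting : ∀ k, IsMittagLefflerLaw β (P.map (T k))
  indep_waiting : iIndepFun T P
  indep_chain : IndepFun (fun ω n => X n ω) (fun ω k => T k ω) P

/-- The transition probabilities `pᵢⱼ(t)`: the probability of `X(t) = j` under the law `P i` of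
the process started at `i`. -/
def transitionProb (P : S → Measure Ω) (X : ℕ → Ω → S) (T : ℕ → Ω → ℝ) (t : ℝ) (i j : S) : ℝ :=
  (P i).real {ω | process X T t ω = j}

/-- The times `t ≥ 0` at which `∑ᵢ ‖pᵢ.(t) - π‖ ≤ ε`. -/
def contMixedTimes [Fintype S] (P : S → Measure Ω) (X : ℕ → Ω → S) (T : ℕ → Ω → ℝ)
    (π : S → ℝ) (ε : ℝ) : Set ℝ :=
  {t : ℝ | 0 ≤ t ∧ ∑ i : S, tvDist (transitionProb P X T t i) π ≤ ε}

/-- The `ε`-mixing time `inf {t ≥ 0 : ∑ᵢ ‖pᵢ.(t) - π‖ ≤ ε}` of the semi-Markov process. -/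
def contMixingTime [Fintype S] (P : S → Measure Ω) (X : ℕ → Ω → S) (T : ℕ → Ω → ℝ)
    (π : S → ℝ) (ε : ℝ) : ℝ :=
  sInf (contMixedTimes P X T π ε)

end TimeChange

end SemiMarkov

end

namespace SemiMarkov

/-! Since `N(t)` is independent of the chain, `p_{ij}(t)` is the mixture of `(Q ^ n) i j` with
weights `P(N(t) = n)` (`hasSum_transitionProb`). The `ℓ¹` distance of `Q ^ n` to `π` is at most 2
and nonincreasing in `n`, so splitting the mixture at `m` bounds the distance at time `t` by `2
P(N(t) < m)` plus the distance at step `m` (`sum_abs_transitionProb_sub_le`).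

Almost surely `N(t) < m` forces `S_m > t`. The Laplace transform of `S_m` is `(1 + s^β)^(-m)`, and
taking `s = 1/t` gives `P(S_m > t) ≤ 2 m t^(-β)` (`measureReal_lt_eventTime_le`). With `m` the
embedded mixing time at level `ε/2` and `t^β = 4 |S| m / ε`, each of the two terms, summed over
starting states, contributes at most `ε/2`. -/

/-! ### Laplace transform of the Mittag-Leffler law -/

lemma neg_rpow_pow {t : ℝ} (ht : 0 ≤ t) (β : ℝ) (k : ℕ) :
    (-(t ^ β)) ^ k = (-1) ^ k * t ^ (β * k) := by
  rw [neg_pow, Real.rpow_mul_natCast ht]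

lemma mittagLeffler_zero (β : ℝ) : mittagLeffler β 0 = 1 := by
  rw [mittagLeffler, tsum_eq_single 0]
  · simp
  · intro k hk
    simp [hk]

lemma integral_mul_exp_neg_mul (s x : ℝ) :
    ∫ t in (0 : ℝ)..x, s * Real.exp (-(s * t)) = 1 - Real.exp (-(s * x)) := by
  have h : ∀ t ∈ Set.uIcc 0 x,
      HasDerivAt (fun t => -Real.exp (-(s * t))) (s * Real.exp (-(s * t))) t := by
    intro t _
    have := (((hasDerivAt_id t).const_mul s).neg.exp).neg
    convert! this using 1
    simp
    ring
  rw [intervalIntegral.integral_eq_sub_of_hasDerivAt h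
    ((by fun_prop : Continuous fun t => s * Real.exp (-(s * t))).intervalIntegrable _ _)]
  simp
  ring

/-- Termwise Laplace transform of the Mittag-Leffler function, in the range where the transformed
series converges absolutely. -/
lemma integral_mittagLeffler_mul_exp {β s : ℝ} (hβ : 0 < β) (hs : 1 < s) :
    ∫ t in Set.Ioi (0 : ℝ), mittagLeffler β (-(t ^ β)) * (s * Real.exp (-(s * t))) =
      1 / (1 + s ^ (-β)) := by
  have hs0 : 0 < s := by linarith
  set q : ℝ := s ^ (-β) with hq
  have hq0 : 0 < q := Real.rpow_pos_of_pos hs0 _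
  have hq1 : q < 1 := Real.rpow_lt_one_of_one_lt_of_neg hs (by linarith)
  let G : ℕ → ℝ → ℝ := fun k t =>
    (s / Real.Gamma (β * k + 1)) * (t ^ ((β * k + 1) - 1) * Real.exp (-(s * t)))
  have hΓ : ∀ k : ℕ, 0 < Real.Gamma (β * k + 1) := fun k => Real.Gamma_pos_of_pos (by positivity)
  have hG_int : ∀ k, IntegrableOn (G k) (Set.Ioi 0) := by
    intro k
    refine Integrable.const_mul ?_ _
    have := integrableOn_rpow_mul_exp_neg_mul_rpow (p := 1) (s := (β * k + 1) - 1) (b := s)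
      (by simp; nlinarith [mul_nonneg hβ.le (Nat.cast_nonneg (α := ℝ) k)]) (by norm_num) hs0
    simpa [Real.rpow_one, neg_mul] using! this
  have hG_val : ∀ k, ∫ t in Set.Ioi (0 : ℝ), G k t = q ^ k := by
    intro k
    have hk : (0 : ℝ) < β * k + 1 := by positivity
    simp only [G]
    rw [integral_const_mul, Real.integral_rpow_mul_exp_neg_mul_Ioi hk hs0,
      Real.rpow_add (by positivity), Real.rpow_one, one_div, hq, Real.inv_rpow hs0.le,
      Real.rpow_neg hs0.le, inv_pow, Real.rpow_mul_natCast hs0.le]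
    field_simp [(hΓ k).ne']
  have hG_nn : ∀ k, ∀ t ∈ Set.Ioi (0 : ℝ), 0 ≤ G k t := by
    intro k t ht
    have := hΓ k
    have : (0 : ℝ) < t := ht
    simp only [G]
    positivity
  -- The terms have `L¹` norms `q ^ k` with `q = s ^ (-β)`; the restriction `1 < s` makes this
  -- geometric series converge.
  have key := hasSum_integral_of_summable_integral_norm
    (μ := volume.restrict (Set.Ioi (0 : ℝ))) (F := fun k t => (-1) ^ k * G k t)
    (fun k => (hG_int k).const_mul _) (by
      have : ∀ k : ℕ, ∫ t in Set.Ioi (0 : ℝ), ‖(-1) ^ k * G k t‖ = q ^ k := by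
        intro k
        rw [← hG_val k]
        refine setIntegral_congr_fun measurableSet_Ioi fun t ht => ?_
        simp [abs_of_nonneg (hG_nn k t ht)]
      simp_rw [this]
      exact summable_geometric_of_lt_one hq0.le hq1)
  have hsum : HasSum (fun k : ℕ => ∫ t in Set.Ioi (0 : ℝ), (-1) ^ k * G k t) (1 / (1 + q)) := by
    simp_rw [integral_const_mul, hG_val, ← mul_pow]
    have := hasSum_geometric_of_abs_lt_one (r := -1 * q) (by simpa [abs_of_pos hq0] using hq1)
    simpa using this
  rw [← key.unique hsum]
  refine setIntegral_congr_fun measurableSet_Ioi fun t ht => ?_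
  simp only [mittagLeffler, G]
  rw [← tsum_mul_right]
  refine tsum_congr fun k => ?_
  rw [neg_rpow_pow (le_of_lt ht)]
  simp only [add_sub_cancel_right]
  ring

lemma IsMittagLefflerLaw.ae_pos {β : ℝ} (hβ : 0 < β) {ν : Measure ℝ} [IsProbabilityMeasure ν]
    (h : IsMittagLefflerLaw β ν) : ∀ᵐ x ∂ν, 0 < x := by
  have h0 := h 0 le_rfl
  rw [Real.zero_rpow hβ.ne', neg_zero, mittagLeffler_zero] at h0
  have : ν (Set.Ioi 0) = 1 := by
    rw [← ENNReal.toReal_eq_one_iff]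
    exact h0
  exact (prob_compl_eq_zero_iff measurableSet_Ioi).2 this

lemma IsMittagLefflerLaw.integrable_exp {β : ℝ} (hβ : 0 < β) {ν : Measure ℝ}
    [IsProbabilityMeasure ν] (h : IsMittagLefflerLaw β ν) {s : ℝ} (hs : 0 ≤ s) :
    Integrable (fun x => Real.exp (-s * id x)) ν := by
  refine Integrable.of_bound (by fun_prop) 1 ?_
  filter_upwards [h.ae_pos hβ] with x hx
  rw [Real.norm_eq_abs, Real.abs_exp, Real.exp_le_one_iff, neg_mul, id]
  have := mul_nonneg hs hx.le
  linarith

/-- Layer cake: as `1 - e^(-sx) = ∫₀ˣ s e^(-st) dt`, its mean is the integral of the tail against `s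
e^(-st)`. -/
lemma IsMittagLefflerLaw.mgf_of_one_lt {β : ℝ} (hβ : 0 < β) {ν : Measure ℝ}
    [IsProbabilityMeasure ν] (h : IsMittagLefflerLaw β ν) {s : ℝ} (hs : 1 < s) :
    mgf id ν (-s) = 1 / (1 + s ^ β) := by
  have hs0 : 0 < s := by linarith
  have hpos := h.ae_pos hβ
  have hint := h.integrable_exp hβ hs0.le
  have layer := lintegral_comp_eq_lintegral_meas_lt_mul ν (f := id)
    (g := fun t => s * Real.exp (-(s * t))) (hpos.mono fun x hx => hx.le) (by fun_prop)
    (fun t _ => (by fun_prop : Continuous fun t => s * Real.exp (-(s * t))).intervalIntegrable _ _)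
    (by filter_upwards with t; positivity)
  have e1 : ∫ x, (1 - Real.exp (-s * id x)) ∂ν =
      ∫ t in Set.Ioi (0 : ℝ), mittagLeffler β (-(t ^ β)) * (s * Real.exp (-(s * t))) := by
    have e2 : ∫ t in Set.Ioi (0 : ℝ), mittagLeffler β (-(t ^ β)) * (s * Real.exp (-(s * t))) =
        ∫ t in Set.Ioi (0 : ℝ), ν.real (Set.Ioi t) * (s * Real.exp (-(s * t))) :=
      setIntegral_congr_fun measurableSet_Ioi fun t ht => by
        simp only [h t (le_of_lt ht)]
    have hmeas : Measurable fun t => ν.real (Set.Ioi t) :=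
      Antitone.measurable fun a b hab => measureReal_mono (Set.Ioi_subset_Ioi hab)
    rw [e2, integral_eq_lintegral_of_nonneg_ae, integral_eq_lintegral_of_nonneg_ae]
    · simp_rw [integral_mul_exp_neg_mul] at layer
      simp only [neg_mul, id] at layer ⊢
      rw [layer]
      congr 1
      refine lintegral_congr fun t => ?_
      rw [ENNReal.ofReal_mul measureReal_nonneg, ofReal_measureReal]
      rfl
    · filter_upwards with t
      have := measureReal_nonneg (μ := ν) (s := Set.Ioi t)
      positivity
    · exact (hmeas.mul (by fun_prop)).aestronglyMeasurable
    · filter_upwards [hpos] with x hx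
      simp only [id, Pi.zero_apply, sub_nonneg, Real.exp_le_one_iff]
      nlinarith
    · fun_prop
  rw [integral_sub (integrable_const _) hint, integral_mittagLeffler_mul_exp hβ hs] at e1
  have e3 : mgf id ν (-s) = 1 - 1 / (1 + s ^ (-β)) := by
    simp only [integral_const, probReal_univ, smul_eq_mul, mul_one] at e1
    rw [mgf]
    linarith
  have hsβ : 0 < s ^ β := Real.rpow_pos_of_pos hs0 _
  rw [e3, Real.rpow_neg hs0.le]
  field_simp
  ring

/-- The Laplace transform of the Mittag-Leffler law. -/
lemma IsMittagLefflerLaw.mgf_neg {β : ℝ} (hβ : 0 < β) {ν : Measure ℝ}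
    [IsProbabilityMeasure ν] (h : IsMittagLefflerLaw β ν) {s : ℝ} (hs : 0 < s) :
    mgf id ν (-s) = 1 / (1 + s ^ β) := by
  have hsub : Set.Iio (0 : ℝ) ⊆ interior (integrableExpSet id ν) := by
    refine interior_maximal (fun u hu => ?_) isOpen_Iio
    have := h.integrable_exp hβ (s := -u) (by simpa using le_of_lt hu)
    simpa [integrableExpSet] using this
  have hf : AnalyticOnNhd ℝ (fun u => mgf id ν (-u)) (Set.Ioi 0) := fun u hu =>
    (analyticAt_mgf (hsub (by simpa using hu))).fun_comp (analyticAt_id.neg)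
  have hg : AnalyticOnNhd ℝ (fun u : ℝ => 1 / (1 + u ^ β)) (Set.Ioi 0) := by
    intro u hu
    have hu' : 0 < u := hu
    have : (1 + u ^ β) ≠ 0 := (add_pos one_pos (Real.rpow_pos_of_pos hu' _)).ne'
    exact analyticAt_const.div
      (analyticAt_const.add (Real.contDiffAt_rpow_const_of_ne hu'.ne').analyticAt) this
  -- Both sides are analytic on `(0, ∞)` and agree near 2, hence everywhere. Small `s` is the range
  -- needed later, with `s = 1/t`.
  refine hf.eqOn_of_preconnected_of_eventuallyEq hg isPreconnected_Ioi
    (z₀ := 2) (by simp) ?_ hs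
  filter_upwards [Ioi_mem_nhds (show (1 : ℝ) < 2 by norm_num)] with u hu
  exact h.mgf_of_one_lt hβ hu

/-! ### Total variation as half the `ℓ¹` distance -/

section TotalVariation

variable {S : Type*} [Fintype S]

lemma abs_sum_sub_le_tvDist (μ ν : S → ℝ) (A : Finset S) :
    |∑ x ∈ A, μ x - ∑ x ∈ A, ν x| ≤ tvDist μ ν :=
  le_ciSup (f := fun A : Finset S => |∑ x ∈ A, μ x - ∑ x ∈ A, ν x|)
    (Set.finite_range _).bddAbove A

lemma two_mul_tvDist {μ ν : S → ℝ} (h : ∑ x, μ x = ∑ x, ν x) :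
    2 * tvDist μ ν = ∑ x, |μ x - ν x| := by
  classical
  have hz : ∀ A : Finset S, ∑ x ∈ A, (μ x - ν x) + ∑ x ∈ Aᶜ, (μ x - ν x) = 0 := by
    intro A
    rw [Finset.sum_add_sum_compl, Finset.sum_sub_distrib, h, sub_self]
  apply le_antisymm
  · have : tvDist μ ν ≤ (∑ x, |μ x - ν x|) / 2 := by
      refine ciSup_le fun A => ?_
      rw [← Finset.sum_sub_distrib]
      have h1 := Finset.abs_sum_le_sum_abs (fun x => μ x - ν x) A
      have h2 := Finset.abs_sum_le_sum_abs (fun x => μ x - ν x) Aᶜ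
      have h3 : ∑ x ∈ Aᶜ, (μ x - ν x) = -∑ x ∈ A, (μ x - ν x) := by linarith [hz A]
      rw [h3, abs_neg] at h2
      linarith [Finset.sum_add_sum_compl A fun x => |μ x - ν x|]
    linarith
  -- The set where `μ ≥ ν` carries exactly half of the `ℓ¹` distance.
  · set A := Finset.univ.filter fun x => 0 ≤ μ x - ν x
    have h1 := abs_sum_sub_le_tvDist μ ν A
    rw [← Finset.sum_sub_distrib] at h1
    have h2 : ∑ x ∈ A, |μ x - ν x| = ∑ x ∈ A, (μ x - ν x) :=
      Finset.sum_congr rfl fun x hx => abs_of_nonneg (Finset.mem_filter.1 hx).2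
    have h3 : ∑ x ∈ Aᶜ, |μ x - ν x| = -∑ x ∈ Aᶜ, (μ x - ν x) := by
      rw [← Finset.sum_neg_distrib]
      refine Finset.sum_congr rfl fun x hx => abs_of_neg ?_
      simpa [A] using hx
    linarith [Finset.sum_add_sum_compl A fun x => |μ x - ν x|, hz A,
      le_abs_self (∑ x ∈ A, (μ x - ν x))]

end TotalVariation

/-! ### Convergence of the embedded chain -/

section Chain

variable {S : Type*} [Fintype S] [DecidableEq S] {Q : Matrix S S ℝ} {π : S → ℝ}

/-- Doeblin contraction: as `v` has total mass zero, replacing `M i j` by `M i j - δ * π j` does not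
change the product, and the new entries are nonnegative with row sums `1 - δ`. -/
lemma sum_abs_vecMul_le {M : Matrix S S ℝ} (hM : M ∈ Matrix.rowStochastic ℝ S)
    (hπ : π ∈ stdSimplex ℝ S) {δ : ℝ} (hδ : ∀ i j, δ * π j ≤ M i j) {v : S → ℝ}
    (hv : ∑ i, v i = 0) :
    ∑ j, |∑ i, v i * M i j| ≤ (1 - δ) * ∑ i, |v i| := by
  have h1 : ∀ j, ∑ i, v i * M i j = ∑ i, v i * (M i j - δ * π j) := by
    intro j
    simp_rw [mul_sub]
    rw [Finset.sum_sub_distrib, ← Finset.sum_mul, hv, zero_mul, sub_zero]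
  calc ∑ j, |∑ i, v i * M i j| ≤ ∑ j, ∑ i, |v i| * (M i j - δ * π j) := by
        refine Finset.sum_le_sum fun j _ => ?_
        rw [h1]
        refine (Finset.abs_sum_le_sum_abs _ _).trans (Finset.sum_le_sum fun i _ => ?_)
        rw [abs_mul, abs_of_nonneg (sub_nonneg.2 (hδ i j))]
    _ = ∑ i, |v i| * (1 - δ) := by
        rw [Finset.sum_comm]
        refine Finset.sum_congr rfl fun i _ => ?_
        rw [← Finset.mul_sum, Finset.sum_sub_distrib, ← Finset.mul_sum, hπ.2,
          Matrix.sum_row_of_mem_rowStochastic hM, mul_one]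
    _ = (1 - δ) * ∑ i, |v i| := by rw [← Finset.sum_mul, mul_comm]

/-- The `ℓ¹` distance `‖(Qⁿ)ᵢ. - π‖₁` of the law at time `n`, started at `i`, to the law `π`. -/
def rowDistance (Q : Matrix S S ℝ) (π : S → ℝ) (i : S) (n : ℕ) : ℝ :=
  ∑ j, |(Q ^ n) i j - π j|

lemma rowDistance_nonneg (i : S) (n : ℕ) : 0 ≤ rowDistance Q π i n :=
  Finset.sum_nonneg fun _ _ => abs_nonneg _

lemma two_mul_sum_tvDist_pow (hQ : Q ∈ Matrix.rowStochastic ℝ S) (hπ : π ∈ stdSimplex ℝ S)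
    (n : ℕ) : 2 * ∑ i, tvDist (fun j => (Q ^ n) i j) π = ∑ i, rowDistance Q π i n := by
  rw [Finset.mul_sum]
  refine Finset.sum_congr rfl fun i _ => two_mul_tvDist ?_
  rw [Matrix.sum_row_of_mem_rowStochastic (pow_mem hQ n), hπ.2]

lemma vecMul_pow_eq_self (h : Matrix.vecMul π Q = π) (n : ℕ) : Matrix.vecMul π (Q ^ n) = π := by
  induction n with
  | zero => simp
  | succ n ih => rw [pow_succ, ← Matrix.vecMul_vecMul, ih, h]

/-- The contraction applies to the row of `Q ^ n` minus `π`. The choice `δ = 0`, `k = 1` gives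
monotonicity, and `δ > 0` geometric decay. -/
lemma rowDistance_add_le (hQ : Q ∈ Matrix.rowStochastic ℝ S) (hπ : IsInvariantLaw Q π)
    {δ : ℝ} {k : ℕ} (hδ : ∀ i j, δ * π j ≤ (Q ^ k) i j) (i : S) (n : ℕ) :
    rowDistance Q π i (n + k) ≤ (1 - δ) * rowDistance Q π i n := by
  refine le_trans (le_of_eq ?_) (sum_abs_vecMul_le (pow_mem hQ k) hπ.1 hδ
    (v := fun j => (Q ^ n) i j - π j) ?_)
  · refine Finset.sum_congr rfl fun j _ => ?_
    have : π j = ∑ l, π l * (Q ^ k) l j := (congrFun (vecMul_pow_eq_self hπ.2 k) j).symm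
    rw [pow_add, Matrix.mul_apply]
    nth_rw 1 [this]
    simp_rw [sub_mul]
    rw [Finset.sum_sub_distrib]
  · rw [Finset.sum_sub_distrib, Matrix.sum_row_of_mem_rowStochastic (pow_mem hQ n), hπ.1.2,
      sub_self]

lemma rowDistance_antitone (hQ : Q ∈ Matrix.rowStochastic ℝ S) (hπ : IsInvariantLaw Q π) (i : S) :
    Antitone (rowDistance Q π i) := by
  refine antitone_nat_of_succ_le fun n => ?_
  have := rowDistance_add_le hQ hπ (δ := 0) (k := 1)
    (fun i j => by simpa using Matrix.nonneg_of_mem_rowStochastic hQ) i n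
  simpa using this

lemma rowDistance_le_two (hQ : Q ∈ Matrix.rowStochastic ℝ S) (hπ : π ∈ stdSimplex ℝ S) (i : S)
    (n : ℕ) : rowDistance Q π i n ≤ 2 := by
  calc rowDistance Q π i n ≤ ∑ j, ((Q ^ n) i j + π j) := by
        refine Finset.sum_le_sum fun j _ => ?_
        have h1 : 0 ≤ (Q ^ n) i j := Matrix.nonneg_of_mem_rowStochastic (pow_mem hQ n)
        have h2 : 0 ≤ π j := hπ.1 j
        rw [abs_le]
        constructor <;> linarith
    _ = 2 := by
        rw [Finset.sum_add_distrib, Matrix.sum_row_of_mem_rowStochastic (pow_mem hQ n), hπ.2]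
        norm_num

lemma pow_mul_pow_le (hQ : ∀ i j, 0 ≤ Q i j) (a b : ℕ) (i k j : S) :
    (Q ^ a) i k * (Q ^ b) k j ≤ (Q ^ (a + b)) i j := by
  have hnn : ∀ (n : ℕ) (i j : S), 0 ≤ (Q ^ n) i j := by
    intro n
    induction n with
    | zero =>
      intro i j
      rw [pow_zero, Matrix.one_apply]
      split_ifs <;> norm_num
    | succ n ih =>
      intro i j
      rw [pow_succ, Matrix.mul_apply]
      exact Finset.sum_nonneg fun l _ => mul_nonneg (ih _ _) (hQ _ _)
  rw [pow_add, Matrix.mul_apply]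
  exact Finset.single_le_sum (f := fun l => (Q ^ a) i l * (Q ^ b) l j)
    (fun l _ => mul_nonneg (hnn _ _ _) (hnn _ _ _)) (Finset.mem_univ k)

/-- Some power of an irreducible aperiodic nonnegative matrix is entrywise positive. -/
lemma exists_pow_pos [Nontrivial S] (hirr : Q.IsIrreducible) (hap : IsAperiodic Q) :
    ∃ n, ∀ i j, 0 < (Q ^ n) i j := by
  have hnn := hirr.nonneg
  have hpath := (Matrix.isIrreducible_iff_exists_pow_pos hnn).1 hirr
  -- The return times to `i` generate an additive semigroup of gcd 1, which contains all large
  -- integers.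
  have hret : ∀ i, ∃ n₀, ∀ n ≥ n₀, 0 < (Q ^ n) i i := by
    intro i
    let s : Set ℕ := {n | 1 ≤ n ∧ 0 < (Q ^ n) i i}
    have hgcd : Nat.setGcd s = 1 :=
      hap i _ fun n h1 h2 => Nat.setGcd_dvd_of_mem (s := s) ⟨h1, h2⟩
    obtain ⟨n₀, hn₀⟩ := Nat.exists_mem_closure_of_ge s
    refine ⟨n₀, fun n hn => ?_⟩
    refine AddSubmonoid.closure_induction (s := s) (motive := fun n _ => 0 < (Q ^ n) i i)
      (fun n hn => hn.2) (by simp) (fun a b _ _ ha hb => ?_) (hn₀ n hn (by simp [hgcd]))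
    exact (mul_pos ha hb).trans_le (pow_mul_pow_le hnn a b i i i)
  choose r hr using hret
  choose k _ hk using hpath
  -- This exponent exceeds every `r i + k i j`; the surplus `a` is spent on a longer return loop at
  -- `i`.
  refine ⟨∑ i, r i + ∑ i, ∑ j, k i j, fun i j => ?_⟩
  have h1 : r i ≤ ∑ i, r i := Finset.single_le_sum (fun _ _ => Nat.zero_le _) (Finset.mem_univ i)
  have h2 : k i j ≤ ∑ i, ∑ j, k i j :=
    (Finset.single_le_sum (f := fun j => k i j) (fun _ _ => Nat.zero_le _)
      (Finset.mem_univ j)).trans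
    (Finset.single_le_sum (f := fun i => ∑ j, k i j) (fun _ _ => Nat.zero_le _)
      (Finset.mem_univ i))
  obtain ⟨a, ha⟩ := Nat.exists_eq_add_of_le (add_le_add h1 h2)
  rw [ha, add_right_comm]
  exact (mul_pos (hr i (r i + a) (Nat.le_add_right _ _)) (hk i j)).trans_le
    (pow_mul_pow_le hnn _ _ i i j)

/-- Convergence to equilibrium of an irreducible aperiodic chain. -/
lemma exists_sum_rowDistance_le [Nontrivial S] (hQ : Q ∈ Matrix.rowStochastic ℝ S)
    (hirr : Q.IsIrreducible) (hap : IsAperiodic Q) (hπ : IsInvariantLaw Q π) {ε : ℝ}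
    (hε : 0 < ε) : ∃ n, ∑ i, rowDistance Q π i n ≤ ε := by
  obtain ⟨k, hk⟩ := exists_pow_pos hirr hap
  obtain ⟨p, hp⟩ := Finite.exists_min fun p : S × S => (Q ^ k) p.1 p.2
  set δ := (Q ^ k) p.1 p.2
  have hδ0 : 0 < δ := hk _ _
  have hδ : ∀ i j, δ * π j ≤ (Q ^ k) i j := by
    intro i j
    have h1 : π j ≤ 1 := by
      rw [← hπ.1.2]
      exact Finset.single_le_sum (fun l _ => hπ.1.1 l) (Finset.mem_univ j)
    exact (mul_le_of_le_one_right hδ0.le h1).trans (hp (i, j))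
  have hδ1 : δ ≤ 1 := Matrix.le_one_of_mem_rowStochastic (pow_mem hQ k)
  have hpow : ∀ r : ℕ, ∑ i, rowDistance Q π i (k * r) ≤ (1 - δ) ^ r * ∑ i, rowDistance Q π i 0 := by
    intro r
    induction r with
    | zero => simp
    | succ r ih =>
      rw [mul_add, mul_one, pow_succ']
      refine (Finset.sum_le_sum fun i _ => rowDistance_add_le hQ hπ hδ i _).trans ?_
      rw [← Finset.mul_sum, mul_assoc]
      exact mul_le_mul_of_nonneg_left ih (by linarith)
  have hlim := (tendsto_pow_atTop_nhds_zero_of_lt_one (r := 1 - δ) (by linarith)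
    (by linarith)).mul_const (∑ i, rowDistance Q π i 0)
  rw [zero_mul] at hlim
  obtain ⟨r, hr⟩ := (hlim.eventually (gt_mem_nhds hε)).exists
  exact ⟨k * r, (hpow r).trans hr.le⟩

/-- Convergence makes the set of mixed times nonempty, so its infimum is attained rather than being
the default value 0. -/
lemma sum_rowDistance_embMixingTime_le [Nontrivial S] (hQ : Q ∈ Matrix.rowStochastic ℝ S)
    (hirr : Q.IsIrreducible) (hap : IsAperiodic Q) (hπ : IsInvariantLaw Q π) {ε : ℝ}
    (hε : 0 < ε) : ∑ i, rowDistance Q π i (embMixingTime Q π ε) ≤ 2 * ε := by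
  obtain ⟨n, hn⟩ := exists_sum_rowDistance_le hQ hirr hap hπ (ε := 2 * ε) (by positivity)
  have hne : {n : ℕ | ∑ i : S, tvDist (fun j => (Q ^ n) i j) π ≤ ε}.Nonempty := by
    refine ⟨n, ?_⟩
    rw [← two_mul_sum_tvDist_pow hQ hπ.1] at hn
    simpa using hn
  have := Nat.sInf_mem hne
  rw [← two_mul_sum_tvDist_pow hQ hπ.1]
  exact mul_le_mul_of_nonneg_left this (by norm_num)

/-- At time 0, testing total variation on `{i}` gives at least `1 - π i`; these sum to `|S| - 1`. -/
lemma embMixingTime_ne_zero [Nontrivial S] (hQ : Q ∈ Matrix.rowStochastic ℝ S)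
    (hirr : Q.IsIrreducible) (hap : IsAperiodic Q) (hπ : IsInvariantLaw Q π) {ε : ℝ}
    (hε : 0 < ε) (hε' : ε < (Fintype.card S : ℝ) - 1) : embMixingTime Q π ε ≠ 0 := by
  intro h0
  have h1 := sum_rowDistance_embMixingTime_le hQ hirr hap hπ hε
  rw [h0, ← two_mul_sum_tvDist_pow hQ hπ.1] at h1
  have h2 : ∑ i : S, (1 - π i) ≤ ∑ i : S, tvDist (fun j => (Q ^ 0) i j) π := by
    refine Finset.sum_le_sum fun i _ => ?_
    have := abs_sum_sub_le_tvDist (fun j => (Q ^ 0) i j) π {i}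
    refine (le_abs_self _).trans ?_
    simpa using this
  rw [Finset.sum_sub_distrib, hπ.1.2] at h2
  simp only [Finset.sum_const, Finset.card_univ, nsmul_eq_mul, mul_one] at h2
  linarith

end Chain

/-! ### The counting process: paths and measurability -/

section CountingPath

variable {Ω : Type*} {T : ℕ → Ω → ℝ}

lemma monotone_eventTime {ω : Ω} (h : ∀ k, 0 < T k ω) : Monotone fun n => eventTime T n ω := by
  refine monotone_nat_of_le_succ fun n => ?_
  rw [eventTime, eventTime, Finset.sum_range_succ]
  linarith [h n]

/-- The hypothesis `hex` bounds the set whose supremum is `eventCount`; an unbounded set would give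
the default value 0. -/
lemma lt_eventTime_of_eventCount_lt {ω : Ω} (hpos : ∀ k, 0 < T k ω) {t : ℝ}
    (hex : ∃ n, t < eventTime T n ω) {m : ℕ} (h : eventCount T t ω < m) :
    t < eventTime T m ω := by
  by_contra! hle
  obtain ⟨n, hn⟩ := hex
  have hbdd : BddAbove {n : ℕ | eventTime T n ω ≤ t} := by
    refine ⟨n, fun k hk => ?_⟩
    by_contra! hlt
    exact absurd (monotone_eventTime hpos hlt.le) (not_le.2 (lt_of_le_of_lt hk hn))
  exact absurd (le_csSup hbdd hle) (not_le.2 h)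

end CountingPath

section CountingMeasurable

variable {Ω : Type*} [MeasurableSpace Ω] {T : ℕ → Ω → ℝ}

lemma measurable_eventTime (hT : ∀ k, Measurable (T k)) (n : ℕ) : Measurable (eventTime T n) :=
  Finset.measurable_fun_sum _ fun k _ => hT k

lemma measurableSet_eventCount_eq (hT : ∀ k, Measurable (T k)) (t : ℝ) (n : ℕ) :
    MeasurableSet {ω | eventCount T t ω = n} := by
  have hset : ∀ n, MeasurableSet {ω | eventTime T n ω ≤ t} := fun n =>
    measurableSet_le (measurable_eventTime hT n) measurable_const
  have hsucc : ∀ n : ℕ, MeasurableSet {ω | eventCount T t ω = n + 1} := by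
    intro n
    have : {ω | eventCount T t ω = n + 1} = {ω | eventTime T (n + 1) ω ≤ t} ∩
        ⋂ k : ℕ, {ω | eventTime T k ω ≤ t → k ≤ n + 1} := by
      ext ω
      simp only [Set.mem_ofPred_eq, Set.mem_inter_iff, Set.mem_iInter]
      constructor
      · intro h
        have hbdd : BddAbove {n : ℕ | eventTime T n ω ≤ t} := by
          by_contra hb
          rw [eventCount, csSup_of_not_bddAbove hb] at h
          simp at h
        have hne : {n : ℕ | eventTime T n ω ≤ t}.Nonempty := by
          by_contra hb
          rw [Set.not_nonempty_iff_eq_empty] at hb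
          rw [eventCount, hb] at h
          simp at h
        rw [← h]
        exact ⟨Nat.sSup_mem hne hbdd, fun k hk => le_csSup hbdd hk⟩
      · rintro ⟨h1, h2⟩
        exact IsGreatest.csSup_eq ⟨h1, fun k hk => h2 k hk⟩
    rw [this]
    refine (hset _).inter (MeasurableSet.iInter fun k => ?_)
    by_cases hk : k ≤ n + 1
    · simp [hk]
    · simp only [hk, imp_false]
      exact (hset k).compl
  cases n with
  | succ n => exact hsucc n
  -- The value 0 also collects the default cases (empty or unbounded set), so it is treated as the
  -- complement of the positive values.
  | zero =>
    have : {ω | eventCount T t ω = 0} = (⋃ n : ℕ, {ω | eventCount T t ω = n + 1})ᶜ := by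
      ext ω
      simp only [Set.mem_ofPred_eq, Set.mem_compl_iff, Set.mem_iUnion, not_exists]
      constructor
      · intro h n
        omega
      · intro h
        by_contra h0
        obtain ⟨n, hn⟩ := Nat.exists_eq_succ_of_ne_zero h0
        exact h n hn
    rw [this]
    exact (MeasurableSet.iUnion hsucc).compl

lemma measurable_eventCount (hT : ∀ k, Measurable (T k)) (t : ℝ) : Measurable (eventCount T t) :=
  measurable_to_countable' fun n => measurableSet_eventCount_eq hT t n

end CountingMeasurable

/-! ### Tail bounds for the event times -/

section EventTimeLaw

variable {Ω : Type*} [MeasurableSpace Ω] {P : Measure Ω} [IsProbabilityMeasure P]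
  {T : ℕ → Ω → ℝ} {β : ℝ}

lemma ae_waiting_pos (hβ : 0 < β) (hT : ∀ k, Measurable (T k))
    (hlaw : ∀ k, IsMittagLefflerLaw β (P.map (T k))) : ∀ᵐ ω ∂P, ∀ k, 0 < T k ω := by
  rw [ae_all_iff]
  intro k
  have := Measure.isProbabilityMeasure_map (μ := P) (hT k).aemeasurable
  exact ae_of_ae_map (hT k).aemeasurable ((hlaw k).ae_pos hβ)

lemma mgf_eventTime (hβ : 0 < β) (hT : ∀ k, Measurable (T k))
    (hlaw : ∀ k, IsMittagLefflerLaw β (P.map (T k))) (hind : iIndepFun T P) {s : ℝ} (hs : 0 < s)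
    (n : ℕ) : mgf (eventTime T n) P (-s) = (1 / (1 + s ^ β)) ^ n := by
  have h1 : eventTime T n = ∑ k ∈ Finset.range n, T k := by
    ext ω
    simp [eventTime]
  rw [h1, hind.mgf_sum hT, Finset.prod_eq_pow_card (b := 1 / (1 + s ^ β)), Finset.card_range]
  intro k _
  have := Measure.isProbabilityMeasure_map (μ := P) (hT k).aemeasurable
  rw [← mgf_id_map (hT k).aemeasurable, (hlaw k).mgf_neg hβ hs]

lemma integrable_exp_eventTime (hβ : 0 < β) (hT : ∀ k, Measurable (T k))
    (hlaw : ∀ k, IsMittagLefflerLaw β (P.map (T k))) {s : ℝ} (hs : 0 < s) (n : ℕ) :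
    Integrable (fun ω => Real.exp (-s * eventTime T n ω)) P := by
  have := measurable_eventTime hT n
  refine Integrable.of_bound (by fun_prop) 1 ?_
  filter_upwards [ae_waiting_pos hβ hT hlaw] with ω hω
  rw [Real.norm_eq_abs, Real.abs_exp, Real.exp_le_one_iff]
  have : 0 ≤ eventTime T n ω := Finset.sum_nonneg fun k _ => (hω k).le
  nlinarith

/-- Markov's inequality for `1 - exp (-Sₙ / t)`, which is at least `1 - 1/e ≥ 1/2` when `Sₙ > t`. -/
lemma measureReal_lt_eventTime_le (hβ : 0 < β) (hT : ∀ k, Measurable (T k))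
    (hlaw : ∀ k, IsMittagLefflerLaw β (P.map (T k))) (hind : iIndepFun T P) {t : ℝ} (ht : 0 < t)
    (n : ℕ) : P.real {ω | t < eventTime T n ω} ≤ 2 * n * t ^ (-β) := by
  have hs : 0 < t⁻¹ := inv_pos.2 ht
  have hint := integrable_exp_eventTime hβ hT hlaw hs n
  have hmgf := mgf_eventTime hβ hT hlaw hind hs n
  have hmeas : MeasurableSet {ω | t < eventTime T n ω} :=
    measurableSet_lt measurable_const (measurable_eventTime hT n)
  set x := t⁻¹ ^ β with hx
  have hx0 : 0 < x := Real.rpow_pos_of_pos hs _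
  have hxt : x = t ^ (-β) := by rw [hx, Real.inv_rpow ht.le, Real.rpow_neg ht.le]
  have hexp : Real.exp (-1) ≤ 1 / 2 := by
    rw [Real.exp_neg, one_div]
    refine inv_anti₀ (by norm_num) ?_
    linarith [Real.add_one_le_exp 1]
  have h1 : ∫ ω, (Set.indicator {ω | t < eventTime T n ω} (fun _ => (1 / 2 : ℝ)) ω) ∂P ≤
      ∫ ω, (1 - Real.exp (-t⁻¹ * eventTime T n ω)) ∂P := by
    refine integral_mono_ae ((integrable_const _).indicator hmeas)
      ((integrable_const _).sub hint) ?_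
    filter_upwards [ae_waiting_pos hβ hT hlaw] with ω hω
    have h0 : 0 ≤ eventTime T n ω := Finset.sum_nonneg fun k _ => (hω k).le
    by_cases hlt : t < eventTime T n ω
    · rw [Set.indicator_of_mem (by exact hlt)]
      have : Real.exp (-t⁻¹ * eventTime T n ω) ≤ Real.exp (-1) := by
        rw [Real.exp_le_exp, neg_mul, neg_le_neg_iff, inv_mul_eq_div, one_le_div ht]
        exact hlt.le
      linarith
    · rw [Set.indicator_of_notMem (by exact hlt), sub_nonneg, Real.exp_le_one_iff]
      nlinarith
  rw [integral_indicator_const _ hmeas, integral_sub (integrable_const _) hint] at h1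
  change _ ≤ _ - mgf (eventTime T n) P (-t⁻¹) at h1
  simp only [hmgf, integral_const, probReal_univ, smul_eq_mul, mul_one] at h1
  -- Bernoulli's inequality, with `1 / (1 + x) ≥ 1 - x`.
  have h2 : 1 - n * x ≤ (1 / (1 + x)) ^ n := by
    have ha : -x ≤ 1 / (1 + x) - 1 := by
      rw [le_sub_iff_add_le, le_div_iff₀ (by positivity)]
      nlinarith
    have hb : -2 ≤ 1 / (1 + x) - 1 := by
      have : 0 < 1 / (1 + x) := by positivity
      linarith
    have := one_add_mul_le_pow hb n
    rw [add_sub_cancel] at this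
    nlinarith [mul_le_mul_of_nonneg_left ha (Nat.cast_nonneg (α := ℝ) n)]
  rw [← hxt]
  linarith

/-- The Chernoff bound at `s = 1` gives `P(Sₙ ≤ t) ≤ e^t 2^(-n)`, so almost surely there is no
explosion. -/
lemma ae_exists_lt_eventTime (hβ : 0 < β) (hT : ∀ k, Measurable (T k))
    (hlaw : ∀ k, IsMittagLefflerLaw β (P.map (T k))) (hind : iIndepFun T P) (t : ℝ) :
    ∀ᵐ ω ∂P, ∃ n, t < eventTime T n ω := by
  set c : ℝ := 1 / (1 + 1 ^ β)
  have hle : ∀ n : ℕ, P.real {ω | ∀ n, eventTime T n ω ≤ t} ≤ Real.exp t * c ^ n := by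
    intro n
    have h1 := measure_le_le_exp_mul_mgf (μ := P) (X := eventTime T n) (t := -1) t (by norm_num)
      (integrable_exp_eventTime hβ hT hlaw one_pos n)
    rw [mgf_eventTime hβ hT hlaw hind one_pos, neg_neg, one_mul] at h1
    exact (measureReal_mono (fun ω (hω : ∀ n, eventTime T n ω ≤ t) => hω n)).trans h1
  have hlim : Filter.Tendsto (fun n : ℕ => Real.exp t * c ^ n) Filter.atTop (nhds 0) := by
    have := (tendsto_pow_atTop_nhds_zero_of_lt_one (r := c) (by simp [c])
      (by simp [c]; norm_num)).const_mul (Real.exp t)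
    simpa using this
  have h0 : P.real {ω | ∀ n, eventTime T n ω ≤ t} = 0 :=
    le_antisymm (ge_of_tendsto' hlim hle) measureReal_nonneg
  rw [measureReal_eq_zero_iff] at h0
  rw [ae_iff]
  simpa using h0

end EventTimeLaw

lemma hasSum_measureReal_inter {Ω ι : Type*} [MeasurableSpace Ω] [MeasurableSpace ι] [Countable ι]
    [MeasurableSingletonClass ι] (P : Measure Ω) [IsFiniteMeasure P] (E : Set Ω) {f : Ω → ι}
    (hf : Measurable f) : HasSum (fun y => P.real (E ∩ {ω | f ω = y})) (P.real E) := by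
  have hmeas : ∀ y, MeasurableSet {ω | f ω = y} := fun y => hf (measurableSet_singleton y)
  have h1 : ∑' y, P (E ∩ {ω | f ω = y}) = P E := by
    have h2 := measure_iUnion (μ := P.restrict E) (f := fun y => {ω | f ω = y})
      (fun a b hab => Set.disjoint_left.2 fun ω (h : f ω = a) (h' : f ω = b) => hab (h ▸ h'))
      hmeas
    have h3 : ⋃ y, {ω | f ω = y} = Set.univ := by
      ext ω
      simp
    rw [h3, Measure.restrict_apply_univ] at h2
    rw [h2]
    refine tsum_congr fun y => ?_
    rw [Measure.restrict_apply (hmeas y), Set.inter_comm]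
  have h4 := ENNReal.hasSum_toReal (f := fun y => P (E ∩ {ω | f ω = y}))
    (by rw [h1]; exact measure_ne_top P E)
  rw [← ENNReal.tsum_toReal_eq fun y => measure_ne_top P _, h1] at h4
  exact h4

/-! ### Marginal laws of the chain from its path probabilities -/

section MarkovChain

variable {S Ω : Type*} [Fintype S] [DecidableEq S] [MeasurableSpace S] [DiscreteMeasurableSpace S]
  [MeasurableSpace Ω] {P : Measure Ω} [IsProbabilityMeasure P] {Q : Matrix S S ℝ} {i : S}
  {X : ℕ → Ω → S}

lemma IsMarkovChainFrom.path_and_future (h : IsMarkovChainFrom P Q i X) (r : ℕ) (j : S) :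
    ∀ (n : ℕ) (x : ℕ → S),
      P.real ({ω | ∀ k ≤ n, X k ω = x k} ∩ {ω | X (n + r) ω = j}) =
        ((if x 0 = i then 1 else 0) * ∏ k ∈ Finset.range n, Q (x k) (x (k + 1))) *
          (Q ^ r) (x n) j := by
  induction r with
  | zero =>
    intro n x
    by_cases hj : x n = j
    · have : {ω | ∀ k ≤ n, X k ω = x k} ∩ {ω | X (n + 0) ω = j} =
          {ω | ∀ k ≤ n, X k ω = x k} := by
        refine Set.inter_eq_left.2 fun ω hω => ?_
        exact (hω n le_rfl).trans hj
      rw [this, h.path_prob]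
      simp [hj]
    · have : {ω | ∀ k ≤ n, X k ω = x k} ∩ {ω | X (n + 0) ω = j} = ∅ := by
        refine Set.eq_empty_of_forall_notMem fun ω hω => hj ?_
        exact (hω.1 n le_rfl).symm.trans hω.2
      rw [this]
      simp [hj]
  | succ r ih =>
    intro n x
    rw [(hasSum_measureReal_inter P _ (h.measurable (n + 1))).unique (hasSum_fintype _), pow_succ',
      Matrix.mul_apply, Finset.mul_sum]
    refine Finset.sum_congr rfl fun y _ => ?_
    -- Splitting over the value `y` of `X (n + 1)` lengthens the prescribed path by one step, which
    -- is why the induction on `r` quantifies over `n` and `x`.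
    set x' := Function.update x (n + 1) y
    have hx : ∀ k ≤ n, x' k = x k := fun k hk => Function.update_of_ne (by omega) _ _
    have hxn : x' (n + 1) = y := Function.update_self _ _ _
    have hset : {ω | ∀ k ≤ n, X k ω = x k} ∩ {ω | X (n + (r + 1)) ω = j} ∩
        {ω | X (n + 1) ω = y} =
        {ω | ∀ k ≤ n + 1, X k ω = x' k} ∩ {ω | X (n + 1 + r) ω = j} := by
      have e : n + (r + 1) = n + 1 + r := by omega
      ext ω
      rw [e]
      simp only [Set.mem_inter_iff, Set.mem_ofPred_eq, Nat.le_succ_iff, Nat.succ_eq_add_one]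
      constructor
      · rintro ⟨⟨h1, h2⟩, h3⟩
        refine ⟨fun k hk => ?_, h2⟩
        rcases hk with hk | rfl
        · rw [hx k hk, h1 k hk]
        · rw [hxn, h3]
      · rintro ⟨h1, h2⟩
        refine ⟨⟨fun k hk => ?_, h2⟩, ?_⟩
        · rw [h1 k (Or.inl hk), hx k hk]
        · rw [h1 (n + 1) (Or.inr rfl), hxn]
    rw [hset, ih, Finset.prod_range_succ, hxn, hx n le_rfl, hx 0 (Nat.zero_le _)]
    have : ∏ k ∈ Finset.range n, Q (x' k) (x' (k + 1)) =
        ∏ k ∈ Finset.range n, Q (x k) (x (k + 1)) := by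
      refine Finset.prod_congr rfl fun k hk => ?_
      have := Finset.mem_range.1 hk
      rw [hx k (by omega), hx (k + 1) (by omega)]
    rw [this]
    ring

lemma IsMarkovChainFrom.measureReal_eq (h : IsMarkovChainFrom P Q i X) (n : ℕ) (j : S) :
    P.real {ω | X n ω = j} = (Q ^ n) i j := by
  have hstart : P.real {ω | X 0 ω = i} = 1 := by
    have := h.path_prob 0 fun _ => i
    simpa using this
  have hae : ∀ᵐ ω ∂P, X 0 ω = i := by
    have hm : MeasurableSet {ω | X 0 ω = i} := h.measurable 0 (measurableSet_singleton i)
    refine (prob_compl_eq_zero_iff hm).2 ?_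
    rw [← ENNReal.toReal_eq_one_iff]
    exact hstart
  have key := h.path_and_future n j 0 fun _ => i
  simp only [zero_add, Finset.range_zero, Finset.prod_empty, if_true, mul_one, one_mul] at key
  rw [← key]
  refine measureReal_congr ?_
  filter_upwards [hae] with ω hω
  refine propext ⟨fun h => ⟨fun k hk => ?_, h⟩, fun h => h.2⟩
  rw [Nat.le_zero.1 hk, hω]

end MarkovChain

/-! ### Transition probabilities as mixtures of powers of `Q` -/

section TransitionProb

variable {S Ω : Type*} [DecidableEq S] [MeasurableSpace S] [MeasurableSpace Ω]
  {Q : Matrix S S ℝ} {π : S → ℝ} {β : ℝ}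
  {P : S → Measure Ω} {X : ℕ → Ω → S} {T : ℕ → Ω → ℝ} {i : S}

lemma hasSum_eventCount (h : IsMittagLefflerSemiMarkovFrom β (P i) Q i X T) (t : ℝ) :
    HasSum (fun n => (P i).real {ω | eventCount T t ω = n}) 1 := by
  have := h.isProbabilityMeasure
  have := hasSum_measureReal_inter (P i) Set.univ (measurable_eventCount h.measurable_waiting t)
  simpa only [Set.univ_inter, probReal_univ] using this

lemma measureReal_eventCount_lt_le (hβ : 0 < β)
    (h : IsMittagLefflerSemiMarkovFrom β (P i) Q i X T) {t : ℝ} (ht : 0 < t) (m : ℕ) :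
    ∑ n ∈ Finset.range m, (P i).real {ω | eventCount T t ω = n} ≤ 2 * m * t ^ (-β) := by
  have := h.isProbabilityMeasure
  refine le_trans ?_ (measureReal_lt_eventTime_le hβ h.measurable_waiting h.law_waiting
    h.indep_waiting ht m)
  have hsum := sum_measureReal_preimage_singleton (μ := P i) (Finset.range m)
    (f := eventCount T t)
    (fun n _ => measurable_eventCount h.measurable_waiting t (measurableSet_singleton n))
  refine hsum.le.trans (ENNReal.toReal_mono (measure_ne_top _ _) (measure_mono_ae ?_))
  filter_upwards [ae_waiting_pos hβ h.measurable_waiting h.law_waiting,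
    ae_exists_lt_eventTime hβ h.measurable_waiting h.law_waiting h.indep_waiting t]
    with ω hpos hex hω
  exact lt_eventTime_of_eventCount_lt hpos hex (Finset.mem_range.1 hω)

variable [Fintype S] [DiscreteMeasurableSpace S]

lemma hasSum_transitionProb (h : IsMittagLefflerSemiMarkovFrom β (P i) Q i X T) (t : ℝ) (j : S) :
    HasSum (fun n => (P i).real {ω | eventCount T t ω = n} * (Q ^ n) i j)
      (transitionProb P X T t i j) := by
  have := h.isProbabilityMeasure
  have hN := measurable_eventCount h.measurable_waiting t
  rw [transitionProb]
  convert hasSum_measureReal_inter (P i) {ω | process X T t ω = j} hN using 2 with n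
  have hset : {ω | process X T t ω = j} ∩ {ω | eventCount T t ω = n} =
      {ω | X n ω = j} ∩ {ω | eventCount T t ω = n} := by
    ext ω
    simp only [Set.mem_inter_iff, Set.mem_ofPred_eq, process]
    constructor <;> rintro ⟨h1, rfl⟩ <;> exact ⟨h1, rfl⟩
  -- The event `N(t) = n` is the preimage of a measurable set of waiting-time sequences, so it is
  -- independent of the chain.
  have hind := h.indep_chain.measure_inter_preimage_eq_mul
    {x : ℕ → S | x n = j} {y : ℕ → ℝ | eventCount (fun k (x : ℕ → ℝ) => x k) t y = n}
    ((measurable_pi_apply n : Measurable fun x : ℕ → S => x n) (measurableSet_singleton j))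
    (measurableSet_eventCount_eq (fun k => measurable_pi_apply k) t n)
  rw [hset, ← h.chain.measureReal_eq n j, mul_comm]
  have hind' := congrArg ENNReal.toReal hind
  rw [ENNReal.toReal_mul] at hind'
  exact hind'.symm

lemma sum_transitionProb (h : IsMittagLefflerSemiMarkovFrom β (P i) Q i X T)
    (hQ : Q ∈ Matrix.rowStochastic ℝ S) (t : ℝ) : ∑ j, transitionProb P X T t i j = 1 := by
  refine (hasSum_sum fun j _ => hasSum_transitionProb h t j).unique ?_
  simp_rw [← Finset.mul_sum, Matrix.sum_row_of_mem_rowStochastic (pow_mem hQ _), mul_one]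
  exact hasSum_eventCount h t

lemma sum_abs_transitionProb_sub_le (hβ : 0 < β)
    (h : IsMittagLefflerSemiMarkovFrom β (P i) Q i X T) (hQ : Q ∈ Matrix.rowStochastic ℝ S)
    (hπ : IsInvariantLaw Q π) {t : ℝ} (ht : 0 < t) (m : ℕ) :
    ∑ j, |transitionProb P X T t i j - π j| ≤ 4 * m * t ^ (-β) + rowDistance Q π i m := by
  set w : ℕ → ℝ := fun n => (P i).real {ω | eventCount T t ω = n}
  have hw1 : HasSum w 1 := hasSum_eventCount h t
  -- Fixing the signs makes the `ℓ¹` distance linear in the transition probabilities, so the mixture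
  -- can be compared termwise.
  set σ : S → ℝ := fun j => if 0 ≤ transitionProb P X T t i j - π j then 1 else -1
  have hσ : ∀ j, |transitionProb P X T t i j - π j| =
      σ j * (transitionProb P X T t i j - π j) := by
    intro j
    simp only [σ]
    split_ifs with h0
    · rw [abs_of_nonneg h0, one_mul]
    · rw [abs_of_neg (not_le.1 h0), neg_one_mul]
  have hσ1 : ∀ j, |σ j| = 1 := by
    intro j
    simp only [σ]
    split_ifs <;> simp
  have hL : HasSum (fun n => ∑ j, σ j * (w n * (Q ^ n) i j - w n * π j))
      (∑ j, |transitionProb P X T t i j - π j|) := by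
    simp_rw [hσ]
    refine hasSum_sum fun j _ => HasSum.mul_left _ ?_
    simpa using (hasSum_transitionProb h t j).sub (hw1.mul_right (π j))
  have hR : HasSum (fun n => 2 * (if n ∈ Finset.range m then w n else 0) +
      w n * rowDistance Q π i m) (2 * ∑ n ∈ Finset.range m, w n + 1 * rowDistance Q π i m) := by
    refine HasSum.add (HasSum.mul_left _ ?_) (hw1.mul_right _)
    have hfin : HasSum (fun n => if n ∈ Finset.range m then w n else 0)
        (∑ n ∈ Finset.range m, if n ∈ Finset.range m then w n else 0) :=
      hasSum_sum_of_ne_finset_zero fun n hn => if_neg hn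
    rwa [Finset.sum_congr rfl fun n hn => if_pos hn] at hfin
  suffices hle : ∀ n, ∑ j, σ j * (w n * (Q ^ n) i j - w n * π j) ≤
      2 * (if n ∈ Finset.range m then w n else 0) + w n * rowDistance Q π i m by
    have := measureReal_eventCount_lt_le hβ h ht m
    linarith [hasSum_le hle hL hR]
  intro n
  have hw0 : 0 ≤ w n := measureReal_nonneg
  have hrow : ∑ j, σ j * (w n * (Q ^ n) i j - w n * π j) ≤ w n * rowDistance Q π i n := by
    rw [rowDistance, Finset.mul_sum]
    refine Finset.sum_le_sum fun j _ => (le_abs_self _).trans (le_of_eq ?_)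
    rw [abs_mul, hσ1, one_mul, ← mul_sub, abs_mul, abs_of_nonneg hw0]
  refine hrow.trans ?_
  -- For `n < m` the distance is bounded by 2; for `n ≥ m`, by its value at `m`.
  split_ifs with hn
  · have h1 := mul_le_mul_of_nonneg_left (rowDistance_le_two hQ hπ.1 i n) hw0
    have h2 := mul_nonneg hw0 (rowDistance_nonneg (Q := Q) (π := π) i m)
    linarith
  · rw [mul_zero, zero_add]
    refine mul_le_mul_of_nonneg_left (rowDistance_antitone hQ hπ i ?_) hw0
    simpa using hn

lemma sum_tvDist_transitionProb_le (hβ : 0 < β)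
    (h : ∀ i, IsMittagLefflerSemiMarkovFrom β (P i) Q i X T) (hQ : Q ∈ Matrix.rowStochastic ℝ S)
    (hπ : IsInvariantLaw Q π) {t : ℝ} (ht : 0 < t) (m : ℕ) :
    ∑ i, tvDist (transitionProb P X T t i) π ≤
      2 * Fintype.card S * m * t ^ (-β) + (∑ i, rowDistance Q π i m) / 2 := by
  have h1 : 2 * ∑ i, tvDist (transitionProb P X T t i) π ≤
      ∑ i, (4 * m * t ^ (-β) + rowDistance Q π i m) := by
    rw [Finset.mul_sum]
    refine Finset.sum_le_sum fun i _ => ?_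
    rw [two_mul_tvDist (by rw [sum_transitionProb (h i) hQ, hπ.1.2])]
    exact sum_abs_transitionProb_sub_le hβ (h i) hQ hπ ht m
  rw [Finset.sum_add_distrib, Finset.sum_const, Finset.card_univ, nsmul_eq_mul] at h1
  linarith

end TransitionProb

end SemiMarkov

/-! ### The comparison of mixing times -/

theorem mainTheorem2 (β : ℝ) (hβ : 0 < β) (hβ1 : β ≤ 1) (N : ℕ) :
    ∃ C₂ : ℝ, 0 < C₂ ∧
      ∀ (S : Type*) [Fintype S] [DecidableEq S] [MeasurableSpace S] [DiscreteMeasurableSpace S]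
        (Ω : Type*) [MeasurableSpace Ω]
        (Q : Matrix S S ℝ) (π : S → ℝ)
        (P : S → Measure Ω) (X : ℕ → Ω → S) (T : ℕ → Ω → ℝ),
        Fintype.card S = N →
        Q ∈ Matrix.rowStochastic ℝ S →
        Q.IsIrreducible →
        SemiMarkov.IsAperiodic Q →
        SemiMarkov.IsInvariantLaw Q π →
        (∀ i : S, SemiMarkov.IsMittagLefflerSemiMarkovFrom β (P i) Q i X T) →
        ∀ ε : ℝ, 0 < ε → ε < 2 * ((N : ℝ) - 1) →
          (SemiMarkov.contMixedTimes P X T π ε).Nonempty ∧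
          SemiMarkov.contMixingTime P X T π ε <
            C₂ * ε ^ (-1 / β) * (SemiMarkov.embMixingTime Q π (ε / 2) : ℝ) ^ (1 / β) := by
  -- The time `t` below uses the constant `(4 N)^(1/β)`; the extra 1 makes the inequality strict,
  -- since `m > 0`.
  refine ⟨(4 * N : ℝ) ^ (1 / β) + 1, by positivity, ?_⟩
  intro S _ _ _ _ Ω _ Q π P X T hcard hQ hirr hap hπ hP ε hε hεN
  have hN1 : (1 : ℝ) < N := by linarith
  have : Nontrivial S := by
    rw [← Fintype.one_lt_card_iff_nontrivial, hcard]
    exact_mod_cast hN1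
  set m := SemiMarkov.embMixingTime Q π (ε / 2)
  have hm : (0 : ℝ) < m := by
    have := SemiMarkov.embMixingTime_ne_zero hQ hirr hap hπ (half_pos hε)
      (by rw [hcard]; linarith)
    exact_mod_cast Nat.pos_of_ne_zero this
  have hd := SemiMarkov.sum_rowDistance_embMixingTime_le hQ hirr hap hπ (half_pos hε)
  have hNpos : (0 : ℝ) < N := by linarith
  set t : ℝ := (4 * N : ℝ) ^ (1 / β) * ε ^ (-1 / β) * (m : ℝ) ^ (1 / β) with ht_def
  have ht : 0 < t := by positivity
  have htβ : t ^ (-β) = ε / (4 * N * m) := by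
    have e1 : t ^ β = 4 * N * ε⁻¹ * m := by
      rw [ht_def, Real.mul_rpow (by positivity) (by positivity),
        Real.mul_rpow (by positivity) (by positivity), ← Real.rpow_mul (by positivity),
        ← Real.rpow_mul hε.le, ← Real.rpow_mul hm.le, div_mul_cancel₀ _ hβ.ne',
        div_mul_cancel₀ _ hβ.ne', Real.rpow_one, Real.rpow_one, Real.rpow_neg_one]
    rw [Real.rpow_neg ht.le, e1]
    field_simp
  have hmem : t ∈ SemiMarkov.contMixedTimes P X T π ε := by
    refine ⟨ht.le, (SemiMarkov.sum_tvDist_transitionProb_le hβ hP hQ hπ ht m).trans ?_⟩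
    have e2 : 2 * (Fintype.card S : ℝ) * m * t ^ (-β) = ε / 2 := by
      rw [htβ, hcard]
      field_simp
      norm_num
    rw [e2]
    linarith
  refine ⟨⟨t, hmem⟩, ?_⟩
  have hle : SemiMarkov.contMixingTime P X T π ε ≤ t := csInf_le ⟨0, fun s hs => hs.1⟩ hmem
  refine hle.trans_lt ?_
  have h1 : 0 < ε ^ (-1 / β) * (m : ℝ) ^ (1 / β) := by positivity
  rw [ht_def]
  nlinarith
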